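/- Let $d\ge 1$, let $n=(n_1,\dots,n_d)$ be a tuple of non-negative integers, and let $p\in\mathbb{C}[z_1,\dots,z_d]$ have degree at most $n_j$ in $z_j$ for each $j$ and no zeros on the closed polydisk $\overline{\mathbb{D}}^d$. Let $\tilde p(z)=z^n\overline{p(1/\bar z_1,\dots,1/\bar z_d)}$ (a polynomial) and $$\mathcal{P}(z,\zeta)=\frac{p(z)\overline{p(\zeta)}-\tilde p(z)\overline{\tilde p(\zeta)}}{\prod_{j=1}^d(1-z_j\bar\zeta_j)},\qquad z,\zeta\in\mathbb{D}^d .$$ For kernels $K,K':\mathbb{D}^d\times\mathbb{D}^d\to\mathbb{C}$ write $K\ge K'$ if $K-K'$ is positive semi-definite. For $S\subset\{1,\dots,d\}$, a positive semi-definite kernel $K$ is called $S$-contractive if $(1-z_j\bar\zeta_j)K(z,\zeta)\ge 0$ for all $j\in S$. A kernel $K$ is called a $\mathcal{P}$-kernel if $\mathcal{P}\ge K\ge 0$ and, for every function $f:\mathbb{D}^d\to\mathbb{C}$, whenever $\mathcal{P}(z,\zeta)\ge f(z)\overline{f(\zeta)}$ and $K(z,\zeta)\ge\epsilon f(z)\overline{f(\zeta)}$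 for some $\epsilon>0$, then $K(z,\zeta)\ge f(z)\overline{f(\zeta)}$. Then for every nonempty $S\subsetneq\{1,\dots,d\}$ there exist $S$-contractive $\mathcal{P}$-kernels $K_S$, $L_S$ such that: (1) $\mathcal{P}=K_S+L_T$ for every partition $S\sqcup T=\{1,\dots,d\}$ with $S,T$ nonempty; (2) for every nonempty $S\subsetneq\{1,\dots,d\}$, $K_S$ is the greatest $S$-contractive kernel bounded above by $\mathcal{P}$, i.e. $K_S\ge K$ for every $S$-contractive kernel $K$ with $K\le\mathcal{P}$. Consequently the decompositions are unique: if $S\sqcup T=\{1,\dots,d\}$ with $S,T$ nonempty, $\mathcal{P}=K'+L'$, and $K'$ is a maximal element (for $\le$) among the $S$-contractive kernels bounded above by $\mathcal{P}$, then $K'=K_S$ and $L'=L_T$. -/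

import Mathlib

open scoped ComplexOrder MatrixOrder ComplexConjugate

noncomputable section

/-- The open unit polydisk `𝔻^d`. -/
abbrev Polydisk (d : ℕ) : Type := {z : Fin d → ℂ // ∀ j, ‖z j‖ < 1}

/-- Kernels `𝔻^d × 𝔻^d → ℂ`, as matrices indexed by the points of the polydisk.
`Matrix.PosSemidef` for an infinite index type is positive semi-definiteness of all finite
sections, and `K ≤ K'` (the `MatrixOrder`) means that `K' - K` is positive semi-definite. -/
abbrev PolydiskKernel (d : ℕ) : Type := Matrix (Polydisk d) (Polydisk d) ℂ

/-- The kernel `f(z) conj f(ζ)`. -/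
def rankOneKernel {d : ℕ} (f : Polydisk d → ℂ) : PolydiskKernel d :=
  Matrix.of fun z ζ => f z * conj (f ζ)

/-- A positive semi-definite kernel `K` is `j`-contractive if `(1 - z_j conj ζ_j) K(z, ζ)` is
positive semi-definite. -/
def IsContractiveAt {d : ℕ} (j : Fin d) (K : PolydiskKernel d) : Prop :=
  0 ≤ K ∧ 0 ≤ (Matrix.of fun z ζ => (1 - z.1 j * conj (ζ.1 j)) * K z ζ : PolydiskKernel d)

/-- A positive semi-definite kernel is `S`-contractive if it is `j`-contractive for all `j ∈ S`. -/
def IsContractiveOn {d : ℕ} (S : Finset (Fin d)) (K : PolydiskKernel d) : Prop :=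
  0 ≤ K ∧ ∀ j ∈ S, IsContractiveAt j K

/-- `K` is a `P`-kernel: `P ≥ K ≥ 0`, and whenever `P ≥ f(z) conj f(ζ)` and
`K ≥ ε f(z) conj f(ζ)` for some `ε > 0`, already `K ≥ f(z) conj f(ζ)`. -/
def IsPKernel {d : ℕ} (P K : PolydiskKernel d) : Prop :=
  0 ≤ K ∧ K ≤ P ∧
    ∀ f : Polydisk d → ℂ, rankOneKernel f ≤ P →
      (∃ ε : ℝ, 0 < ε ∧ (ε : ℂ) • rankOneKernel f ≤ K) → rankOneKernel f ≤ K

/-- The reflection `p̃(z) = z^n conj (p(1 / conj z))` of a polynomial `p` of multidegree at most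
`n`: if `p = ∑ c_α z^α`, then `p̃ = ∑ conj c_α z^(n - α)`. -/
def reflectPoly {d : ℕ} (n : Fin d →₀ ℕ) (p : MvPolynomial (Fin d) ℂ) :
    MvPolynomial (Fin d) ℂ :=
  ∑ α ∈ p.support, MvPolynomial.monomial (n - α) (conj (p.coeff α))

/-- Off the coordinate hyperplanes the reflection is given by `z^n conj (p(1 / conj z))`. -/
theorem eval_reflectPoly {d : ℕ} (n : Fin d →₀ ℕ) (p : MvPolynomial (Fin d) ℂ)
    (hn : ∀ j, p.degreeOf j ≤ n j) (z : Fin d → ℂ) (hz : ∀ j, z j ≠ 0) :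
    MvPolynomial.eval z (reflectPoly n p) =
      (∏ j, z j ^ n j) * conj (MvPolynomial.eval (fun j => 1 / conj (z j)) p) := by
  rw [reflectPoly, map_sum, MvPolynomial.eval_eq', map_sum, Finset.mul_sum]
  refine Finset.sum_congr rfl fun α hα => ?_
  rw [MvPolynomial.eval_monomial, Finsupp.prod_fintype _ _ (by simp), map_mul, map_prod,
    mul_left_comm, ← Finset.prod_mul_distrib]
  congr 1
  refine Finset.prod_congr rfl fun j _ => ?_
  have h : α j ≤ n j := (MvPolynomial.monomial_le_degreeOf j hα).trans (hn j)
  rw [Finsupp.tsub_apply, pow_sub₀ _ (hz j) h]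
  simp

/-- The kernel
`𝒫(z, ζ) = (p(z) conj p(ζ) - p̃(z) conj p̃(ζ)) / ∏_j (1 - z_j conj ζ_j)`. -/
def reflectKernel {d : ℕ} (n : Fin d →₀ ℕ) (p : MvPolynomial (Fin d) ℂ) : PolydiskKernel d :=
  Matrix.of fun z ζ =>
    (MvPolynomial.eval z.1 p * conj (MvPolynomial.eval ζ.1 p) -
        MvPolynomial.eval z.1 (reflectPoly n p) *
          conj (MvPolynomial.eval ζ.1 (reflectPoly n p))) /
      ∏ j, (1 - z.1 j * conj (ζ.1 j))

end

/-! Work in `ℓ²(ℤ^d)`, the Fourier side of `L²` of the torus, where multiplication by `z_j` is a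
shift and the Hardy space `H` is the subspace supported on the non-negative orthant. Since `|p̃| =
|p|` on the torus, `p̃/p` acts as an isometry `Φ`; it commutes with the shifts and preserves every
subspace cut out by non-negativity in some coordinates. The vectors `v_z = conj p(z) k_z - conj
p̃(z) Φ k_z`, with `k_z` the Szegő vector, lie in the model space `H ⊖ ΦH` and have Gram kernel `𝒫`.
A vector `x` there is identified with the function `z ↦ ⟪v_z, x⟫ = p(z) x(z)`.

For given `S` the model space is an orthogonal sum `M ⊕ N`. Here `N` is the closure of the vectors
`P Φ g`, where `P` cuts down to frequencies non-negative on `S` and `g` has frequencies non-negative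
off `S` with a negative coordinate in `S`; `N` is invariant under the shifts off `S`. Its complement
`M` consists of the `x ∈ H` orthogonal to all `Φ e_m` with `m` non-negative off `S`, and is the
largest part invariant under the shifts in `S`. Projecting `v_z` to `M` and `N` gives `K_S` and
`L_T`.

Kernels dominated by a Gram kernel are controlled by the functions they dominate
(`exists_inner_of_rankOneKernel_le`). Those dominated by a multiple of an `S`-contractive kernel
below `𝒫` correspond to a shift-invariant set, which therefore lies in `M`; this yields maximality
(`le_gram_starProjection_of_isContractiveOn`, `subset_invariantSpace`). -/

noncomputable section

/-! ### Positive kernels, Gram kernels and their compressions to closed subspaces -/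

section GramKernels

open Matrix

variable {d : ℕ} {E : Type*} [NormedAddCommGroup E] [InnerProductSpace ℂ E]

/-- The sesquilinear form on finitely supported functions attached to a kernel. -/
def kernelForm (K : PolydiskKernel d) (c e : Polydisk d →₀ ℂ) : ℂ :=
  c.sum fun z a => e.sum fun ζ b => star a * K z ζ * b

theorem kernelForm_self_nonneg {K : PolydiskKernel d} (hK : 0 ≤ K) (c : Polydisk d →₀ ℂ) :
    0 ≤ kernelForm K c c :=
  (Matrix.nonneg_iff_posSemidef.1 hK).2 c

theorem kernelForm_sub (K K' : PolydiskKernel d) (c e : Polydisk d →₀ ℂ) :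
    kernelForm (K - K') c e = kernelForm K c e - kernelForm K' c e := by
  simp only [kernelForm, Finsupp.sum, ← Finset.sum_sub_distrib, Matrix.sub_apply]
  refine Finset.sum_congr rfl fun z _ => Finset.sum_congr rfl fun ζ _ => by ring

theorem kernelForm_smul (t : ℂ) (K : PolydiskKernel d) (c e : Polydisk d →₀ ℂ) :
    kernelForm (t • K) c e = t * kernelForm K c e := by
  simp only [kernelForm, Finsupp.sum, Finset.mul_sum, Matrix.smul_apply, smul_eq_mul]
  refine Finset.sum_congr rfl fun z _ => Finset.sum_congr rfl fun ζ _ => by ring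

theorem kernelForm_mono {K K' : PolydiskKernel d} (h : K ≤ K') (c : Polydisk d →₀ ℂ) :
    kernelForm K c c ≤ kernelForm K' c c := by
  have := kernelForm_self_nonneg (sub_nonneg.2 h) c
  rwa [kernelForm_sub, sub_nonneg] at this

theorem kernel_le_of_form {K K' : PolydiskKernel d} (hK : K.IsHermitian) (hK' : K'.IsHermitian)
    (h : ∀ c, kernelForm K c c ≤ kernelForm K' c c) : K ≤ K' := by
  refine Matrix.le_iff.2 ⟨hK'.sub hK, fun c => ?_⟩
  have := kernelForm_sub K' K c c
  rw [kernelForm] at this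
  rw [this]
  exact sub_nonneg.2 (h c)

theorem inner_self_eq_ofReal (x : E) : inner ℂ x x = ((‖x‖ ^ 2 : ℝ) : ℂ) := by
  rw [inner_self_eq_norm_sq_to_K]
  simp

theorem kernelForm_gram (v : Polydisk d → E) (c e : Polydisk d →₀ ℂ) :
    kernelForm (gram ℂ v) c e =
      inner ℂ (Finsupp.linearCombination ℂ v c) (Finsupp.linearCombination ℂ v e) := by
  simp only [kernelForm, Finsupp.linearCombination_apply, Finsupp.sum, sum_inner, inner_sum,
    inner_smul_left, inner_smul_right, gram_apply]
  rw [Finset.sum_comm]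
  refine Finset.sum_congr rfl fun z _ => ?_
  rw [Finset.mul_sum]
  refine Finset.sum_congr rfl fun ζ _ => ?_
  simp only [Complex.star_def]; ring

theorem gram_nonneg (v : Polydisk d → E) : 0 ≤ gram ℂ v := by
  refine Matrix.nonneg_iff_posSemidef.2 ⟨isHermitian_gram _ _, fun c => ?_⟩
  have := kernelForm_gram v c c
  rw [kernelForm] at this
  rw [this]
  rw [inner_self_eq_ofReal]
  exact Complex.zero_le_real.2 (sq_nonneg _)

theorem rankOneKernel_isHermitian (f : Polydisk d → ℂ) : (rankOneKernel f).IsHermitian := by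
  ext z ζ
  simp [rankOneKernel, mul_comm]

theorem kernelForm_rankOne (f : Polydisk d → ℂ) (c : Polydisk d →₀ ℂ) :
    kernelForm (rankOneKernel f) c c = ((‖c.sum fun z a => a * conj (f z)‖ ^ 2 : ℝ) : ℂ) := by
  push_cast
  rw [← Complex.conj_mul']
  simp only [kernelForm, rankOneKernel, Finsupp.sum, Matrix.of_apply, map_sum, Finset.sum_mul_sum]
  refine Finset.sum_congr rfl fun z _ => Finset.sum_congr rfl fun ζ _ => ?_
  simp; ring

/-- Functions `z ↦ ⟪v z, x⟫` with `‖x‖ ≤ 1` are dominated by the Gram kernel of `v`. -/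
theorem rankOneKernel_le_smul_gram (v : Polydisk d → E) (x : E) {C : ℝ} (hC : ‖x‖ ^ 2 ≤ C) :
    rankOneKernel (fun z => inner ℂ (v z) x) ≤ (C : ℂ) • gram ℂ v := by
  refine kernel_le_of_form (rankOneKernel_isHermitian _) ?_ fun c => ?_
  · ext z ζ
    simp
  rw [kernelForm_rankOne, kernelForm_smul, kernelForm_gram, inner_self_eq_ofReal]
  have h : (c.sum fun z a => a * conj (inner ℂ (v z) x)) =
      inner ℂ x (Finsupp.linearCombination ℂ v c) := by
    simp [Finsupp.linearCombination_apply, Finsupp.sum]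
  rw [h]
  have h2 := norm_inner_le_norm (𝕜 := ℂ) x (Finsupp.linearCombination ℂ v c)
  have h3 : ‖inner ℂ x (Finsupp.linearCombination ℂ v c)‖ ^ 2 ≤
      C * ‖Finsupp.linearCombination ℂ v c‖ ^ 2 := by
    calc _ ≤ (‖x‖ * ‖Finsupp.linearCombination ℂ v c‖) ^ 2 := by gcongr
      _ = ‖x‖ ^ 2 * ‖Finsupp.linearCombination ℂ v c‖ ^ 2 := by ring
      _ ≤ _ := by gcongr
  exact_mod_cast h3

/-- Functions dominated by a multiple of the Gram kernel of `v` are of the form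
`z ↦ ⟪v z, x⟫`. -/
theorem exists_inner_of_rankOneKernel_le [CompleteSpace E] (v : Polydisk d → E)
    (f : Polydisk d → ℂ) {C : ℝ} (hC : 0 ≤ C) (h : rankOneKernel f ≤ (C : ℂ) • gram ℂ v) :
    ∃ x : E, (∀ z, f z = inner ℂ (v z) x) ∧ ‖x‖ ^ 2 ≤ C := by
  set F := Finsupp.linearCombination ℂ v
  set ℓ := Finsupp.linearCombination ℂ (fun z => conj (f z))
  have hle : ∀ c, ‖ℓ c‖ ≤ √C * ‖F c‖ := by
    intro c
    have h1 := kernelForm_mono h c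
    rw [kernelForm_rankOne, kernelForm_smul, kernelForm_gram, inner_self_eq_ofReal] at h1
    have h2 : ‖c.sum fun z a => a * conj (f z)‖ ^ 2 ≤ C * ‖F c‖ ^ 2 := by exact_mod_cast h1
    have h3 : ‖ℓ c‖ ^ 2 ≤ (√C * ‖F c‖) ^ 2 := by
      rw [mul_pow, Real.sq_sqrt hC]
      simpa [ℓ, Finsupp.linearCombination_apply] using h2
    exact (sq_le_sq₀ (norm_nonneg _) (by positivity)).1 h3
  have hker : LinearMap.ker F ≤ LinearMap.ker ℓ := by
    intro c hc
    have := hle c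
    rw [LinearMap.mem_ker.1 hc, norm_zero, mul_zero] at this
    exact LinearMap.mem_ker.2 (norm_le_zero_iff.1 this)
  -- By the bound, `ℓ c` depends only on `F c`, with norm at most `√C`. Hahn–Banach extends this
  -- functional to `E` and Riesz represents it.
  let g₀ : LinearMap.range F →ₗ[ℂ] ℂ :=
    ((LinearMap.ker F).liftQ ℓ hker).comp F.quotKerEquivRange.symm.toLinearMap
  have hg₀ : ∀ c, g₀ ⟨F c, LinearMap.mem_range_self F c⟩ = ℓ c := by
    intro c
    have h1 : F.quotKerEquivRange.symm ⟨F c, LinearMap.mem_range_self F c⟩ =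
        Submodule.Quotient.mk c := by
      rw [LinearEquiv.symm_apply_eq]
      rfl
    simp only [g₀, LinearMap.comp_apply, LinearEquiv.coe_coe, h1]
    rfl
  let g₁ : LinearMap.range F →L[ℂ] ℂ := g₀.mkContinuous (√C) (by
    rintro ⟨_, c, rfl⟩
    rw [hg₀]
    exact hle c)
  obtain ⟨g, hg, hgn⟩ := exists_extension_norm_eq (LinearMap.range F) g₁
  refine ⟨(InnerProductSpace.toDual ℂ E).symm g, fun z => ?_, ?_⟩
  · rw [← inner_conj_symm, InnerProductSpace.toDual_symm_apply]
    have h1 : F (Finsupp.single z 1) = v z := by simp [F]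
    have h2 := hg ⟨F (Finsupp.single z 1), LinearMap.mem_range_self F _⟩
    have h3 : g₁ ⟨F (Finsupp.single z 1), LinearMap.mem_range_self F _⟩ = conj (f z) := by
      change g₀ _ = _
      rw [hg₀]
      simp [ℓ]
    rw [h3] at h2
    simp only [h1] at h2
    rw [h2, Complex.conj_conj]
  · rw [LinearIsometryEquiv.norm_map, hgn]
    have := g₀.mkContinuous_norm_le (Real.sqrt_nonneg C) (by
      rintro ⟨_, c, rfl⟩
      rw [hg₀]
      exact hle c)
    calc ‖g₁‖ ^ 2 ≤ √C ^ 2 := by gcongr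
      _ = C := Real.sq_sqrt hC

/-- A Cauchy–Schwarz inequality for positive semi-definite kernels. -/
theorem rankOneKernel_sum_le_smul {K : PolydiskKernel d} (hK : 0 ≤ K) (c : Polydisk d →₀ ℂ) :
    rankOneKernel (fun z => c.sum fun ζ b => K z ζ * b) ≤ kernelForm K c c • K := by
  have hH := (Matrix.nonneg_iff_posSemidef.1 hK).1
  -- The form of `K` may be degenerate, so only a pre-inner product is available; Cauchy–Schwarz
  -- still holds for it.
  let core : PreInnerProductSpace.Core ℂ (Polydisk d →₀ ℂ) :=
    { inner := kernelForm K
      conj_inner_symm := fun x y => by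
        simp only [kernelForm, Finsupp.sum, map_sum]
        rw [Finset.sum_comm]
        refine Finset.sum_congr rfl fun z _ => Finset.sum_congr rfl fun ζ _ => ?_
        have := hH.apply z ζ
        simp only [Complex.star_def] at this ⊢
        rw [map_mul, map_mul, Complex.conj_conj, this]
        ring
      re_inner_nonneg := fun x => (Complex.le_def.1 (kernelForm_self_nonneg hK x)).1
      add_left := fun x y w => by
        refine Finsupp.sum_add_index' (by simp) fun z a b => ?_
        simp [Finsupp.sum, ← Finset.sum_add_distrib, add_mul]
      smul_left := fun x y r => by
        simp only [kernelForm]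
        rw [Finsupp.sum_smul_index (by simp)]
        simp [Finsupp.sum, Finset.mul_sum, mul_assoc] }
  have hnn := kernelForm_self_nonneg hK c
  refine kernel_le_of_form (rankOneKernel_isHermitian _) ?_ fun e => ?_
  · rw [Matrix.IsHermitian, Matrix.conjTranspose_smul, hH.eq, Complex.star_def,
      Complex.conj_eq_iff_im.2 (Complex.le_def.1 hnn).2.symm]
  have hne := kernelForm_self_nonneg hK e
  have hcs := @InnerProductSpace.Core.inner_mul_inner_self_le ℂ _ _ _ _ core e c
  have hsum : ‖e.sum fun z a => a * conj (c.sum fun ζ b => K z ζ * b)‖ =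
      ‖kernelForm K e c‖ := by
    rw [← Complex.norm_conj]
    congr 1
    simp only [kernelForm, Finsupp.sum, map_sum, map_mul, Finset.mul_sum, Complex.conj_conj,
      Complex.star_def, mul_assoc]
  have hsymm : ‖kernelForm K c e‖ = ‖kernelForm K e c‖ := by
    rw [← Complex.norm_conj]
    exact congrArg _ (core.conj_inner_symm e c)
  change ‖kernelForm K e c‖ * ‖kernelForm K c e‖ ≤
    (kernelForm K e e).re * (kernelForm K c c).re at hcs
  rw [hsymm] at hcs
  rw [kernelForm_rankOne, kernelForm_smul, hsum]
  rw [Complex.le_def] at hnn hne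
  rw [Complex.le_def]
  simp only [Complex.zero_re, Complex.zero_im] at hnn hne
  constructor
  · rw [Complex.mul_re, ← hnn.2, Complex.ofReal_re]
    nlinarith
  · rw [Complex.mul_im, ← hnn.2, ← hne.2, Complex.ofReal_im]
    simp

/-- Multiplying a kernel by `f(z) conj f(ζ)` preserves positivity. -/
theorem mul_rankOne_nonneg {K : PolydiskKernel d} (hK : 0 ≤ K) (a : Polydisk d → ℂ) :
    0 ≤ (Matrix.of fun z ζ => a z * conj (a ζ) * K z ζ : PolydiskKernel d) := by
  have hP := Matrix.nonneg_iff_posSemidef.1 hK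
  refine Matrix.nonneg_iff_posSemidef.2 ⟨?_, fun c => ?_⟩
  · ext z ζ
    have := hP.1.apply z ζ
    simp only [Complex.star_def] at this
    simp [this, mul_comm]
  · let e : Polydisk d →₀ ℂ := Finsupp.onFinset c.support (fun z => conj (a z) * c z) (by
      intro z hz
      rw [Finsupp.mem_support_iff]
      exact right_ne_zero_of_mul hz)
    have h := kernelForm_self_nonneg hK e
    convert h using 1
    rw [kernelForm, Finsupp.sum, Finsupp.onFinset_sum _ (by simp)]
    refine Finset.sum_congr rfl fun z _ => ?_
    rw [Finsupp.sum, Finsupp.onFinset_sum _ (by simp)]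
    refine Finset.sum_congr rfl fun ζ _ => ?_
    simp; ring

/-- The kernel `(1 - z_j conj ζ_j) ⟪w z, w ζ⟫` is itself the Gram kernel of `w z - conj z_j • U (w
z)`: the two cross terms and the last term combine to a single `-z_j conj ζ_j`. -/
theorem isContractiveAt_gram {j : Fin d} (w : Polydisk d → E) (U : E →ₗᵢ[ℂ] E)
    (h : ∀ z ζ, inner ℂ (w z) (U (w ζ)) = z.1 j * inner ℂ (w z) (w ζ)) :
    IsContractiveAt j (gram ℂ w) := by
  refine ⟨gram_nonneg w, ?_⟩
  convert gram_nonneg (fun z => w z - conj (z.1 j) • U (w z)) using 1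
  ext z ζ
  have h' : inner ℂ (U (w z)) (w ζ) = conj (ζ.1 j) * inner ℂ (w z) (w ζ) := by
    rw [← inner_conj_symm, h, map_mul, inner_conj_symm]
  simp only [of_apply, gram_apply, inner_sub_left, inner_sub_right, inner_smul_left,
    inner_smul_right, LinearIsometry.inner_map_map, h, h', Complex.conj_conj]
  ring

theorem inner_starProjection_starProjection (M : Submodule ℂ E) [M.HasOrthogonalProjection]
    (x y : E) : inner ℂ (M.starProjection x) (M.starProjection y) =
      inner ℂ x (M.starProjection y) := by
  rw [Submodule.inner_starProjection_left_eq_right,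
    Submodule.starProjection_eq_self_iff.2 (Submodule.starProjection_apply_mem M y)]

theorem isContractiveAt_gram_starProjection {j : Fin d} (v : Polydisk d → E) (U : E →ₗᵢ[ℂ] E)
    (M : Submodule ℂ E) [M.HasOrthogonalProjection] (hU : ∀ x ∈ M, U x ∈ M)
    (h : ∀ x ∈ M, ∀ z, inner ℂ (v z) (U x) = z.1 j * inner ℂ (v z) x) :
    IsContractiveAt j (gram ℂ fun z => M.starProjection (v z)) := by
  refine isContractiveAt_gram _ U fun z ζ => ?_
  have hm : M.starProjection (v ζ) ∈ M := Submodule.starProjection_apply_mem _ _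
  rw [Submodule.inner_starProjection_left_eq_right,
    Submodule.starProjection_eq_self_iff.2 (hU _ hm), h _ hm,
    inner_starProjection_starProjection]

theorem gram_eq_add_of_orthogonal (v : Polydisk d → E) (N : Submodule ℂ E)
    [N.HasOrthogonalProjection] :
    gram ℂ v = gram ℂ (fun z => v z - N.starProjection (v z)) +
      gram ℂ (fun z => N.starProjection (v z)) := by
  ext z ζ
  simp only [Matrix.add_apply, gram_apply, inner_sub_left, inner_sub_right,
    inner_starProjection_starProjection]
  rw [Submodule.inner_starProjection_left_eq_right]
  ring

theorem gram_starProjection_le (v : Polydisk d → E) (N : Submodule ℂ E)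
    [N.HasOrthogonalProjection] : gram ℂ (fun z => N.starProjection (v z)) ≤ gram ℂ v := by
  rw [gram_eq_add_of_orthogonal v N]
  exact le_add_of_nonneg_left (gram_nonneg _)

/-- A function dominated by the Gram kernel is represented by a vector in any closed subspace
containing the Gram vectors. -/
theorem exists_mem_inner_of_rankOneKernel_le [CompleteSpace E] {v : Polydisk d → E}
    (W : Submodule ℂ E) [W.HasOrthogonalProjection] (hv : ∀ z, v z ∈ W)
    (f : Polydisk d → ℂ) {C : ℝ} (hC : 0 ≤ C) (h : rankOneKernel f ≤ (C : ℂ) • gram ℂ v) :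
    ∃ x ∈ W, (∀ z, f z = inner ℂ (v z) x) ∧ ‖x‖ ^ 2 ≤ C := by
  obtain ⟨x, hx, hxC⟩ := exists_inner_of_rankOneKernel_le v f hC h
  refine ⟨W.starProjection x, Submodule.starProjection_apply_mem _ _, fun z => ?_, ?_⟩
  · rw [hx z, ← Submodule.inner_starProjection_left_eq_right,
      Submodule.starProjection_eq_self_iff.2 (hv z)]
  · have := Submodule.norm_starProjection_apply_le W x
    exact le_trans (by gcongr) hxC

/-- Compressing the Gram vectors to a closed subspace on which they separate points gives a
`P`-kernel. -/
theorem isPKernel_gram_starProjection [CompleteSpace E] {v : Polydisk d → E}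
    (W M : Submodule ℂ E) [W.HasOrthogonalProjection] [M.HasOrthogonalProjection]
    (hv : ∀ z, v z ∈ W) (hMW : M ≤ W)
    (hsep : ∀ x ∈ W, ∀ y ∈ W, (∀ z, inner ℂ (v z) x = inner ℂ (v z) y) → x = y) :
    IsPKernel (gram ℂ v) (gram ℂ fun z => M.starProjection (v z)) := by
  refine ⟨gram_nonneg _, gram_starProjection_le v M, ?_⟩
  rintro f hf ⟨ε, hε, hfε⟩
  have hf1 : rankOneKernel f ≤ ((1 : ℝ) : ℂ) • gram ℂ v := by simpa using hf
  obtain ⟨x, hxW, hx, hx1⟩ := exists_mem_inner_of_rankOneKernel_le W hv f zero_le_one hf1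
  have hfε' : rankOneKernel f ≤ ((ε⁻¹ : ℝ) : ℂ) • gram ℂ fun z => M.starProjection (v z) := by
    have hε' : (ε : ℂ) ≠ 0 := by exact_mod_cast hε.ne'
    have h1 := (Matrix.le_iff.1 hfε).smul (a := ((ε⁻¹ : ℝ) : ℂ))
      (Complex.zero_le_real.2 (inv_nonneg.2 hε.le))
    rw [smul_sub, smul_smul, Complex.ofReal_inv, inv_mul_cancel₀ hε', one_smul] at h1
    rw [Complex.ofReal_inv]
    exact Matrix.le_iff.2 h1
  obtain ⟨y, hyM, hy, -⟩ := exists_mem_inner_of_rankOneKernel_le M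
    (fun z => Submodule.starProjection_apply_mem M (v z)) f (inv_nonneg.2 hε.le) hfε'
  -- `x` carries the norm bound 1 coming from `P`, `y` carries membership in `M`; both represent
  -- `f`, so separation merges the two properties.
  have hxy : x = y := hsep x hxW y (hMW hyM) fun z => by
    rw [← hx, hy, Submodule.inner_starProjection_left_eq_right,
      Submodule.starProjection_eq_self_iff.2 hyM]
  have := rankOneKernel_le_smul_gram (fun z => M.starProjection (v z)) y (hxy ▸ hx1)
  rw [Complex.ofReal_one, one_smul] at this
  rwa [funext hy]

/-- If `M` contains every subset of `W` that is invariant under the isometries `U j`, `j ∈ S`,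
which act on the functions `z ↦ ⟪v z, x⟫` as multiplication by the coordinates, then compressing
the Gram vectors to `M` dominates every `S`-contractive kernel below the Gram kernel. -/
theorem le_gram_starProjection_of_isContractiveOn [CompleteSpace E] {v : Polydisk d → E}
    (W M : Submodule ℂ E) [W.HasOrthogonalProjection] [M.HasOrthogonalProjection]
    (hv : ∀ z, v z ∈ W) (S : Finset (Fin d)) (U : Fin d → E →ₗᵢ[ℂ] E)
    (hU : ∀ j, ∀ x ∈ W, ∀ y ∈ W, (∀ z, inner ℂ (v z) y = z.1 j * inner ℂ (v z) x) → U j x = y)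
    (hM : ∀ Y : Set E, Y ⊆ W → (∀ j ∈ S, ∀ x ∈ Y, U j x ∈ Y) → Y ⊆ M)
    {K : PolydiskKernel d} (hK : IsContractiveOn S K) (hle : K ≤ gram ℂ v) :
    K ≤ gram ℂ fun z => M.starProjection (v z) := by
  have hsmul : ∀ {C : ℝ}, 0 ≤ C → (C : ℂ) • K ≤ (C : ℂ) • gram ℂ v := fun {C} hC => by
    have := (Matrix.le_iff.1 hle).smul (a := (C : ℂ)) (Complex.zero_le_real.2 hC)
    rw [smul_sub] at this
    exact Matrix.le_iff.2 this
  -- The vectors whose functions are dominated by a multiple of `K`. Contractivity, `z_j conj ζ_j K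
  -- ≤ K`, makes this set invariant under `U j` with the same constant.
  let Y : Set E := {x | x ∈ W ∧ ∃ C : ℝ, 0 ≤ C ∧
    rankOneKernel (fun z => inner ℂ (v z) x) ≤ (C : ℂ) • K}
  have hY : Y ⊆ M := by
    refine hM Y (fun x hx => hx.1) ?_
    rintro j hj x ⟨hxW, C, hC, hxC⟩
    have hjK : (C : ℂ) • (Matrix.of fun z ζ => z.1 j * conj (ζ.1 j) * K z ζ : PolydiskKernel d) ≤
        (C : ℂ) • K := by
      have h1 := (Matrix.nonneg_iff_posSemidef.1 (hK.2 j hj).2).smul (a := (C : ℂ))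
        (Complex.zero_le_real.2 hC)
      refine Matrix.le_iff.2 ?_
      convert h1 using 1
      ext z ζ
      simp; ring
    have hxj : rankOneKernel (fun z : Polydisk d => z.1 j * inner ℂ (v z) x) ≤ (C : ℂ) • K := by
      refine le_trans ?_ hjK
      rw [← sub_nonneg] at hxC ⊢
      convert mul_rankOne_nonneg hxC (fun z => z.1 j) using 1
      ext z ζ
      simp [rankOneKernel]; ring
    obtain ⟨y, hyW, hy, -⟩ := exists_mem_inner_of_rankOneKernel_le W hv _ hC
      (hxj.trans (hsmul hC))
    have hUx := hU j x hxW y hyW fun z => (hy z).symm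
    rw [hUx]
    exact ⟨hyW, C, hC, by simpa only [hy] using hxj⟩
  have hKH := (Matrix.nonneg_iff_posSemidef.1 hK.1).1
  refine kernel_le_of_form hKH (isHermitian_gram _ _) fun c => ?_
  have hnn := kernelForm_self_nonneg hK.1 c
  obtain ⟨C, hC, hCK⟩ : ∃ C : ℝ, 0 ≤ C ∧ kernelForm K c c = C := by
    have := Complex.le_def.1 hnn
    exact ⟨(kernelForm K c c).re, this.1, Complex.ext rfl this.2.symm⟩
  have hcs := rankOneKernel_sum_le_smul hK.1 c
  rw [hCK] at hcs
  obtain ⟨x, hxW, hx, hxC⟩ := exists_mem_inner_of_rankOneKernel_le W hv _ hC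
    (hcs.trans (hsmul hC))
  have hxM : x ∈ M := hY ⟨hxW, C, hC, by simpa only [hx] using hcs⟩
  set F := Finsupp.linearCombination ℂ fun z => M.starProjection (v z)
  have hform : kernelForm K c c = inner ℂ (F c) x := by
    have h1 : kernelForm K c c = c.sum fun z a => star a * c.sum fun ζ b => K z ζ * b := by
      simp only [kernelForm, Finsupp.sum, Finset.mul_sum, mul_assoc]
    rw [h1]
    simp only [F, Finsupp.linearCombination_apply, Finsupp.sum, sum_inner, inner_smul_left]
    refine Finset.sum_congr rfl fun z _ => ?_
    rw [Submodule.inner_starProjection_left_eq_right,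
      Submodule.starProjection_eq_self_iff.2 hxM, ← hx z]
    rfl
  rw [kernelForm_gram, inner_self_eq_ofReal, hCK, Complex.real_le_real]
  -- Together with `‖x‖² ≤ C` this forces `C ≤ ‖F c‖²`, which is the desired comparison of forms.
  have h2 : C ≤ ‖F c‖ * ‖x‖ := by
    have := norm_inner_le_norm (𝕜 := ℂ) (F c) x
    rwa [← hform, hCK, Complex.norm_real, Real.norm_of_nonneg hC] at this
  by_contra hlt
  push Not at hlt
  have h3 : (‖F c‖ * ‖x‖) ^ 2 < C ^ 2 := by
    have hCpos : 0 < C := lt_of_le_of_lt (sq_nonneg _) hlt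
    calc (‖F c‖ * ‖x‖) ^ 2 = ‖F c‖ ^ 2 * ‖x‖ ^ 2 := by ring
      _ ≤ ‖F c‖ ^ 2 * C := by gcongr
      _ < C * C := by gcongr
      _ = C ^ 2 := by ring
  exact absurd h2 (not_le.2 (lt_of_pow_lt_pow_left₀ 2 hC h3))

end GramKernels

/-! ### Products of absolutely convergent series and one-sided geometric sequences -/

section ProductSums

theorem summable_norm_and_hasSum_pi_prod {ι : Type*} :
    ∀ {d : ℕ} {f : Fin d → ι → ℂ} {s : Fin d → ℂ}, (∀ j, Summable fun i => ‖f j i‖) →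
      (∀ j, HasSum (f j) (s j)) →
      (Summable fun m : Fin d → ι => ‖∏ j, f j (m j)‖) ∧
        HasSum (fun m : Fin d → ι => ∏ j, f j (m j)) (∏ j, s j) := by
  intro d
  induction d with
  | zero =>
    intro f s _ _
    simp only [Finset.univ_eq_empty, Finset.prod_empty]
    exact ⟨(hasSum_fintype _).summable, by simp⟩
  | succ d ih =>
    intro f s hf hs
    obtain ⟨h1, h2⟩ := ih (f := fun j => f j.succ) (s := fun j => s j.succ)
      (fun j => hf _) (fun j => hs _)
    have hn := Summable.mul_norm (hf 0) h1
    have hp := (hs 0).mul h2 hn.of_norm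
    constructor
    · rw [← (Fin.consEquiv (fun _ : Fin (d + 1) => ι)).summable_iff]
      refine hn.congr fun m => ?_
      simp [Fin.consEquiv, Fin.prod_univ_succ]
    · rw [← (Fin.consEquiv (fun _ : Fin (d + 1) => ι)).hasSum_iff, Fin.prod_univ_succ]
      refine hp.congr_fun fun m => ?_
      simp [Fin.consEquiv, Fin.prod_univ_succ]

/-- The one-sided geometric sequence `w ^ n` on `ℤ`. -/
def intGeom (w : ℂ) (n : ℤ) : ℂ := if 0 ≤ n then w ^ n.toNat else 0

theorem intGeom_natCast (w : ℂ) (n : ℕ) : intGeom w n = w ^ n := by simp [intGeom]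

theorem intGeom_of_neg (w : ℂ) {n : ℤ} (hn : n < 0) : intGeom w n = 0 := by
  simp [intGeom, hn]

theorem intGeom_succ (w : ℂ) {n : ℤ} (hn : 0 ≤ n) : intGeom w (n + 1) = w * intGeom w n := by
  lift n to ℕ using hn
  rw [show (n : ℤ) + 1 = ((n + 1 : ℕ) : ℤ) by simp, intGeom_natCast, intGeom_natCast, pow_succ']

theorem intGeom_mul (a b : ℂ) (n : ℤ) : intGeom a n * intGeom b n = intGeom (a * b) n := by
  unfold intGeom; split_ifs <;> simp [mul_pow]

theorem conj_intGeom (a : ℂ) (n : ℤ) : conj (intGeom a n) = intGeom (conj a) n := by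
  unfold intGeom; split_ifs <;> simp

theorem support_intGeom (w : ℂ) : ∀ n ∉ Set.range ((↑) : ℕ → ℤ), intGeom w n = 0 := by
  intro n hn
  refine intGeom_of_neg w (not_le.1 fun h => hn ⟨n.toNat, Int.toNat_of_nonneg h⟩)

theorem hasSum_intGeom {w : ℂ} (hw : ‖w‖ < 1) : HasSum (intGeom w) (1 - w)⁻¹ := by
  rw [← Function.Injective.hasSum_iff Nat.cast_injective (support_intGeom w)]
  exact (hasSum_geometric_of_norm_lt_one hw).congr_fun fun n => (intGeom_natCast w n)

theorem summable_norm_intGeom {w : ℂ} (hw : ‖w‖ < 1) : Summable fun n => ‖intGeom w n‖ := by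
  rw [← Function.Injective.summable_iff (Nat.cast_injective (R := ℤ))
    (fun n hn => by rw [support_intGeom w n hn, norm_zero])]
  refine (summable_geometric_of_lt_one (norm_nonneg w) hw).congr fun n => ?_
  simp [intGeom_natCast]

end ProductSums

/-! ### The Hardy space inside `ℓ²(ℤ^d)` and its reproducing vectors -/

section SequenceModel

variable {d : ℕ}

/-- Square summable functions on `ℤ^d`, the Fourier side of `L²` of the torus. -/
abbrev TorusSeq (d : ℕ) : Type := lp (fun _ : Fin d → ℤ => ℂ) 2

/-- Translation by `a` on square summable functions. -/
def shift (a : Fin d → ℤ) : TorusSeq d →ₗᵢ[ℂ] TorusSeq d :=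
  LinearMap.isometryOfInner
    { toFun := fun x => ⟨fun m => x (m - a), by
        refine memℓp_gen ?_
        exact ((Equiv.subRight a).summable_iff (f := fun m => ‖x m‖ ^ ((2 : ENNReal).toReal))).2
          ((lp.memℓp x).summable (by simp))⟩
      map_add' := fun _ _ => rfl
      map_smul' := fun _ _ => rfl }
    (fun x y => by
      rw [lp.inner_eq_tsum, lp.inner_eq_tsum]
      exact (Equiv.subRight a).tsum_eq (fun m => inner ℂ (x m) (y m)))

@[simp]
theorem shift_apply (a : Fin d → ℤ) (x : TorusSeq d) (m : Fin d → ℤ) :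
    shift a x m = x (m - a) := rfl

theorem shift_shift (a b : Fin d → ℤ) (x : TorusSeq d) :
    shift a (shift b x) = shift (a + b) x := by
  ext m
  simp [sub_sub]

theorem shift_zero (x : TorusSeq d) : shift 0 x = x := by
  ext m
  simp

theorem inner_shift_right (a : Fin d → ℤ) (x y : TorusSeq d) :
    inner ℂ x (shift a y) = inner ℂ (shift (-a) x) y := by
  rw [← LinearIsometry.inner_map_map (shift (-a)), shift_shift, neg_add_cancel, shift_zero]

/-- The functions supported on a set of frequencies. -/
def coordSubspace (I : Set (Fin d → ℤ)) : Submodule ℂ (TorusSeq d) where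
  carrier := {x | ∀ m ∉ I, x m = 0}
  zero_mem' := fun _ _ => rfl
  add_mem' := fun hx hy m hm => by simp [hx m hm, hy m hm]
  smul_mem' := fun c x hx m hm => by simp [hx m hm]

theorem mem_coordSubspace {I : Set (Fin d → ℤ)} {x : TorusSeq d} :
    x ∈ coordSubspace I ↔ ∀ m ∉ I, x m = 0 := Iff.rfl

/-- The standard unit vectors. -/
def unitVec (m : Fin d → ℤ) : TorusSeq d := lp.single 2 m 1

theorem unitVec_apply (m l : Fin d → ℤ) : unitVec m l = if l = m then 1 else 0 := by
  rw [unitVec, lp.single_apply, Pi.single_apply]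

theorem inner_unitVec (m : Fin d → ℤ) (x : TorusSeq d) : inner ℂ (unitVec m) x = x m := by
  rw [unitVec, lp.inner_single_left]
  simp

theorem unitVec_mem {I : Set (Fin d → ℤ)} {m : Fin d → ℤ} (hm : m ∈ I) :
    unitVec m ∈ coordSubspace I := by
  intro l hl
  rw [unitVec_apply, if_neg]
  rintro rfl
  exact hl hm

theorem coordSubspace_eq_iInf (I : Set (Fin d → ℤ)) :
    (coordSubspace I : Set (TorusSeq d)) = ⋂ m ∈ Iᶜ, {x | inner ℂ (unitVec m) x = 0} := by
  ext x
  simp [mem_coordSubspace, inner_unitVec]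

theorem isClosed_coordSubspace (I : Set (Fin d → ℤ)) :
    IsClosed (coordSubspace I : Set (TorusSeq d)) := by
  rw [coordSubspace_eq_iInf]
  exact isClosed_biInter fun m _ => isClosed_eq (by fun_prop) continuous_const

instance (I : Set (Fin d → ℤ)) : CompleteSpace (coordSubspace I) :=
  (isClosed_coordSubspace I).completeSpace_coe

theorem starProjection_coordSubspace_apply_mem {I : Set (Fin d → ℤ)} {m : Fin d → ℤ}
    (hm : m ∈ I) (x : TorusSeq d) : (coordSubspace I).starProjection x m = x m := by
  rw [← inner_unitVec, ← Submodule.inner_starProjection_left_eq_right,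
    Submodule.starProjection_eq_self_iff.2 (unitVec_mem hm), inner_unitVec]

theorem starProjection_coordSubspace_apply_notMem {I : Set (Fin d → ℤ)} {m : Fin d → ℤ}
    (hm : m ∉ I) (x : TorusSeq d) : (coordSubspace I).starProjection x m = 0 :=
  Submodule.starProjection_apply_mem (coordSubspace I) x m hm

theorem inner_eq_zero_of_disjoint {x y : TorusSeq d} (h : ∀ m, x m = 0 ∨ y m = 0) :
    inner ℂ x y = 0 := by
  rw [lp.inner_eq_tsum]
  convert tsum_zero with m
  rcases h m with h | h <;> simp [h]

/-- The frequencies that are non-negative in the coordinates belonging to `S`. -/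
def nonnegOn (S : Set (Fin d)) : Set (Fin d → ℤ) := {m | ∀ j ∈ S, 0 ≤ m j}

/-- The Szegő kernel vector at a point of the polydisk. -/
def szegoVec (z : Polydisk d) : TorusSeq d :=
  ⟨fun m => ∏ j, intGeom (conj (z.1 j)) (m j), by
    refine memℓp_gen ?_
    -- Only norms matter, so the squared norm of an entry is the norm of a geometric term with ratio
    -- `(conj z_j)²`.
    have hz : ∀ j, ‖conj (z.1 j) * conj (z.1 j)‖ < 1 := fun j => by
      rw [norm_mul, Complex.norm_conj]
      exact mul_lt_one_of_nonneg_of_lt_one_left (norm_nonneg _) (z.2 j) (z.2 j).le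
    have := (summable_norm_and_hasSum_pi_prod (fun j => summable_norm_intGeom (hz j))
      (fun j => hasSum_intGeom (hz j))).1
    refine this.congr fun m => ?_
    simp only [← intGeom_mul, Finset.prod_mul_distrib, norm_mul]
    simp [sq]⟩

theorem szegoVec_apply (z : Polydisk d) (m : Fin d → ℤ) :
    szegoVec z m = ∏ j, intGeom (conj (z.1 j)) (m j) := rfl

theorem szegoVec_mem (z : Polydisk d) : szegoVec z ∈ coordSubspace (nonnegOn Set.univ) := by
  intro m hm
  simp only [nonnegOn, Set.mem_univ, true_implies, Set.mem_ofPred_eq, not_forall, not_le] at hm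
  obtain ⟨j, hj⟩ := hm
  exact Finset.prod_eq_zero (Finset.mem_univ j) (intGeom_of_neg _ hj)

theorem inner_szegoVec_szegoVec (z ζ : Polydisk d) :
    inner ℂ (szegoVec z) (szegoVec ζ) = (∏ j, (1 - z.1 j * conj (ζ.1 j)))⁻¹ := by
  have hz : ∀ j, ‖z.1 j * conj (ζ.1 j)‖ < 1 := fun j => by
    rw [norm_mul, Complex.norm_conj]
    exact mul_lt_one_of_nonneg_of_lt_one_left (norm_nonneg _) (z.2 j) (ζ.2 j).le
  have h := (summable_norm_and_hasSum_pi_prod (fun j => summable_norm_intGeom (hz j))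
    (fun j => hasSum_intGeom (hz j))).2
  rw [← Finset.prod_inv_distrib, ← h.tsum_eq, lp.inner_eq_tsum]
  refine tsum_congr fun m => ?_
  simp only [szegoVec_apply, RCLike.inner_apply, map_prod, conj_intGeom, Complex.conj_conj,
    ← Finset.prod_mul_distrib, intGeom_mul, mul_comm]

/-- The backward shift multiplies `szegoVec z` by `conj z_j` at non-negative frequencies only.
Elsewhere, for instance where `m j = -1`, this can fail, but there `x` vanishes. -/
theorem inner_szegoVec_shift (z : Polydisk d) (j : Fin d) {x : TorusSeq d}
    (hx : x ∈ coordSubspace (nonnegOn Set.univ)) :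
    inner ℂ (szegoVec z) (shift (Pi.single j 1) x) = z.1 j * inner ℂ (szegoVec z) x := by
  rw [inner_shift_right, lp.inner_eq_tsum, lp.inner_eq_tsum, ← tsum_mul_left]
  refine tsum_congr fun m => ?_
  by_cases hm : m ∈ nonnegOn Set.univ
  · have h : szegoVec z (m - -(Pi.single j 1 : Fin d → ℤ)) = conj (z.1 j) * szegoVec z m := by
      rw [szegoVec_apply, szegoVec_apply]
      have : ∀ i, intGeom (conj (z.1 i)) ((m - -(Pi.single j 1 : Fin d → ℤ)) i) =
          (if i = j then conj (z.1 j) else 1) * intGeom (conj (z.1 i)) (m i) := fun i => by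
        by_cases hi : i = j
        · subst hi
          simp [intGeom_succ _ (hm i trivial)]
        · simp [hi]
      rw [Finset.prod_congr rfl fun i _ => this i, Finset.prod_mul_distrib]
      simp
    rw [shift_apply, h]
    simp; ring
  · rw [hx m hm]
    simp

/-- The Szegő vectors separate the points of the Hardy space. -/
theorem eq_zero_of_inner_szegoVec_eq_zero {x : TorusSeq d}
    (hx : x ∈ coordSubspace (nonnegOn Set.univ)) (h : ∀ z, inner ℂ (szegoVec z) x = 0) :
    x = 0 := by
  -- On the torus of radius 1/2 the values of `x` form an absolutely convergent Fourier series with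
  -- coefficients `a`; any radius strictly between 0 and 1 would do. Its sum vanishes identically,
  -- hence so does each coefficient.
  let r : Polydisk d := ⟨fun _ => 1 / 2, fun _ => by norm_num⟩
  let a : (Fin d → ℤ) → ℂ := fun m => inner ℂ (szegoVec r m) (x m)
  have ha : Summable fun m => ‖a m • UnitAddTorus.mFourier (d := Fin d) m‖ := by
    have := (lp.summable_inner (𝕜 := ℂ) (szegoVec r) x).norm
    simpa only [norm_smul, UnitAddTorus.mFourier_norm, mul_one] using this
  obtain ⟨F, hF⟩ := ha.of_norm
  have hF0 : F = 0 := by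
    ext θ
    have h1 : HasSum (fun m => a m * UnitAddTorus.mFourier m θ) (F θ) := by
      simpa using (ContinuousMap.evalCLM ℂ θ).hasSum hF
    let z : Polydisk d := ⟨fun j => 1 / 2 * fourier 1 (θ j), fun j => by
      rw [norm_mul, fourier_apply, Circle.norm_coe]; norm_num⟩
    have h2 := lp.hasSum_inner (𝕜 := ℂ) (szegoVec z) x
    rw [h z] at h2
    refine h1.unique (h2.congr_fun fun m => ?_)
    by_cases hm : m ∈ nonnegOn Set.univ
    · have h3 : conj (szegoVec z m) = conj (szegoVec r m) * UnitAddTorus.mFourier m θ := by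
        simp only [szegoVec_apply, map_prod, conj_intGeom, Complex.conj_conj,
          UnitAddTorus.mFourier, ContinuousMap.coe_mk, ← Finset.prod_mul_distrib]
        refine Finset.prod_congr rfl fun j _ => ?_
        obtain ⟨n, hn⟩ := Int.eq_ofNat_of_zero_le (hm j trivial)
        rw [hn]
        simp only [intGeom_natCast, z, r, mul_pow]
        simp [fourier_apply, AddCircle.toCircle_nsmul]
      simp only [a, RCLike.inner_apply, h3]
      ring
    · simp [a, hx m hm]
  rw [hF0] at hF
  have haz : ∀ m, a m = 0 := by
    intro m
    let := instMeasureSpaceUnitAddCircle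
    have : MeasureTheory.IsProbabilityMeasure
        (MeasureTheory.volume : MeasureTheory.Measure UnitAddCircle) :=
      inferInstanceAs (MeasureTheory.IsProbabilityMeasure AddCircle.haarAddCircle)
    have h2 := ((innerSL ℂ (UnitAddTorus.mFourierLp (d := Fin d) 2 m)).comp
      (ContinuousMap.toLp (E := ℂ) 2 MeasureTheory.volume ℂ)).hasSum hF
    have h3 := UnitAddTorus.orthonormal_mFourier (d := Fin d)
    rw [orthonormal_iff_ite] at h3
    have h4 : ∀ l, inner ℂ (UnitAddTorus.mFourierLp (d := Fin d) 2 m)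
        (ContinuousMap.toLp (E := ℂ) 2 MeasureTheory.volume ℂ (UnitAddTorus.mFourier l)) =
        if m = l then 1 else 0 := fun l => h3 m l
    simp only [map_smul, ContinuousLinearMap.comp_apply, innerSL_apply_apply, map_zero, h4, smul_eq_mul,
      mul_ite, mul_one, mul_zero] at h2
    exact (hasSum_ite_eq' m (a m)).unique (h2.congr_fun fun l => by
      by_cases hl : m = l <;> simp [hl])
  ext m
  by_cases hm : m ∈ nonnegOn Set.univ
  · have h1 := haz m
    simp only [a, RCLike.inner_apply, mul_eq_zero, map_eq_zero] at h1
    refine h1.resolve_right ?_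
    rw [szegoVec_apply]
    refine Finset.prod_ne_zero_iff.2 fun j _ => ?_
    rw [intGeom, if_pos (hm j trivial)]
    simp [r]
  · exact hx m hm

end SequenceModel

/-! ### The Banach algebra of forward shifts and the multiplier `p̃/p` -/

section ShiftAlgebra

variable {d : ℕ}

/-- Translation as a bounded operator. -/
def shiftCLM (a : Fin d → ℤ) : TorusSeq d →L[ℂ] TorusSeq d := (shift a).toContinuousLinearMap

@[simp]
theorem shiftCLM_apply (a : Fin d → ℤ) (x : TorusSeq d) : shiftCLM a x = shift a x := rfl

theorem shiftCLM_mul (a b : Fin d → ℤ) : shiftCLM a * shiftCLM b = shiftCLM (a + b) :=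
  ContinuousLinearMap.ext fun x => shift_shift a b x

theorem shiftCLM_zero : shiftCLM (0 : Fin d → ℤ) = 1 :=
  ContinuousLinearMap.ext fun x => shift_zero x

/-- The norm closed algebra generated by the coordinate shifts. -/
def shiftAlgebra (d : ℕ) : Subalgebra ℂ (TorusSeq d →L[ℂ] TorusSeq d) :=
  (Algebra.adjoin ℂ (Set.range fun j : Fin d => shiftCLM (Pi.single j 1))).topologicalClosure

theorem isClosed_shiftAlgebra : IsClosed (shiftAlgebra d : Set (TorusSeq d →L[ℂ] TorusSeq d)) :=
  Subalgebra.isClosed_topologicalClosure _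

instance : CompleteSpace (shiftAlgebra d) := isClosed_shiftAlgebra.completeSpace_coe

theorem shiftAlgebra_le {B : Subalgebra ℂ (TorusSeq d →L[ℂ] TorusSeq d)}
    (hB : IsClosed (B : Set (TorusSeq d →L[ℂ] TorusSeq d)))
    (h : ∀ j, shiftCLM (Pi.single j 1) ∈ B) : shiftAlgebra d ≤ B :=
  Subalgebra.topologicalClosure_minimal (Algebra.adjoin_le (by rintro _ ⟨j, rfl⟩; exact h j)) hB

theorem isClosed_centralizer_singleton (T : TorusSeq d →L[ℂ] TorusSeq d) :
    IsClosed (Subalgebra.centralizer ℂ {T} : Set (TorusSeq d →L[ℂ] TorusSeq d)) := by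
  have : (Subalgebra.centralizer ℂ {T} : Set (TorusSeq d →L[ℂ] TorusSeq d)) =
      {R | T * R = R * T} := by
    ext R
    simp [Set.mem_centralizer_iff]
  rw [this]
  exact isClosed_eq (by fun_prop) (by fun_prop)

theorem commute_shiftCLM {T : TorusSeq d →L[ℂ] TorusSeq d} (hT : T ∈ shiftAlgebra d)
    (a : Fin d → ℤ) : shiftCLM a * T = T * shiftCLM a := by
  have h := shiftAlgebra_le (isClosed_centralizer_singleton (shiftCLM a)) (fun j => by
    rw [Subalgebra.mem_centralizer_iff]
    rintro _ rfl
    rw [shiftCLM_mul, shiftCLM_mul, add_comm]) hT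
  exact (Subalgebra.mem_centralizer_iff ℂ).1 h _ rfl

/-- Centralizers are norm closed, so commutation passes from the generators to the closure, one
factor at a time. Commutativity opens the way to Gelfand theory. -/
theorem mul_comm_of_mem_shiftAlgebra {T R : TorusSeq d →L[ℂ] TorusSeq d}
    (hT : T ∈ shiftAlgebra d) (hR : R ∈ shiftAlgebra d) : T * R = R * T := by
  have h := shiftAlgebra_le (isClosed_centralizer_singleton T) (fun j => by
    rw [Subalgebra.mem_centralizer_iff]
    rintro _ rfl
    exact (commute_shiftCLM hT _).symm) hR
  exact (Subalgebra.mem_centralizer_iff ℂ).1 h _ rfl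

instance : NormedCommRing (shiftAlgebra d) :=
  { (inferInstance : NormedRing (shiftAlgebra d)) with
    mul_comm := fun a b => Subtype.ext (mul_comm_of_mem_shiftAlgebra a.2 b.2) }

instance : NormedAlgebra ℂ (shiftAlgebra d) :=
  { (inferInstance : Algebra ℂ (shiftAlgebra d)) with
    norm_smul_le := fun r x => norm_smul_le r (x : TorusSeq d →L[ℂ] TorusSeq d) }

/-- Operators preserving a closed subspace form a norm closed algebra. Hence the inverse of an
invertible `polyShift p`, taken within this algebra, also keeps frequencies non-negative. -/
theorem apply_mem_of_mem_shiftAlgebra {C : Submodule ℂ (TorusSeq d)}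
    (hC : IsClosed (C : Set (TorusSeq d)))
    (h : ∀ j, ∀ x ∈ C, shift (Pi.single j 1) x ∈ C) {T : TorusSeq d →L[ℂ] TorusSeq d}
    (hT : T ∈ shiftAlgebra d) {x : TorusSeq d} (hx : x ∈ C) : T x ∈ C := by
  let B : Subalgebra ℂ (TorusSeq d →L[ℂ] TorusSeq d) :=
    { carrier := {T | ∀ x ∈ C, T x ∈ C}
      mul_mem' := fun hS hT x hx => hS _ (hT x hx)
      add_mem' := fun hS hT x hx => C.add_mem (hS x hx) (hT x hx)
      algebraMap_mem' := fun r x hx => by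
        rw [Algebra.algebraMap_eq_smul_one]
        exact C.smul_mem r hx }
  have hB : IsClosed (B : Set (TorusSeq d →L[ℂ] TorusSeq d)) := by
    have : (B : Set (TorusSeq d →L[ℂ] TorusSeq d)) = ⋂ x ∈ C, {T | T x ∈ C} := by
      ext T
      simp [B]
    rw [this]
    exact isClosed_biInter fun x _ => hC.preimage (ContinuousLinearMap.apply ℂ _ x).continuous
  exact shiftAlgebra_le hB h hT x hx

/-- The coordinate shifts as elements of the shift algebra. -/
def coordShift (j : Fin d) : shiftAlgebra d :=
  ⟨shiftCLM (Pi.single j 1),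
    Subalgebra.le_topologicalClosure _ (Algebra.subset_adjoin ⟨j, rfl⟩)⟩

theorem norm_coordShift_le (j : Fin d) : ‖coordShift j‖ ≤ 1 :=
  (shift _).norm_toContinuousLinearMap_le

/-- A polynomial in the coordinate shifts. -/
def polyShift (q : MvPolynomial (Fin d) ℂ) : shiftAlgebra d := MvPolynomial.aeval coordShift q

/-- A polynomial without zeros on the closed polydisk is invertible in the shift algebra. -/
theorem isUnit_polyShift {p : MvPolynomial (Fin d) ℂ}
    (hp : ∀ z : Fin d → ℂ, (∀ j, ‖z j‖ ≤ 1) → MvPolynomial.eval z p ≠ 0) :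
    IsUnit (polyShift p) := by
  by_contra h
  -- A non-invertible element is killed by a character. Its values on the shifts form a point of the
  -- closed polydisk, at which `p` would vanish.
  obtain ⟨χ, hχ⟩ := WeakDual.CharacterSpace.exists_apply_eq_zero h
  refine hp (fun j => χ (coordShift j)) (fun j => ?_) ?_
  · have h1 : χ (coordShift j) ∈ spectrum ℂ (coordShift j) :=
      AlgHom.apply_mem_spectrum χ (coordShift j)
    refine (spectrum.norm_le_norm_mul_of_mem h1).trans ?_
    have h2 : ‖(1 : shiftAlgebra d)‖ ≤ 1 := ContinuousLinearMap.norm_id_le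
    exact mul_le_one₀ (norm_coordShift_le j) (norm_nonneg _) h2
  · have h1 := MvPolynomial.comp_aeval_apply (coordShift (d := d))
      (WeakDual.CharacterSpace.toAlgHom χ) p
    rw [← MvPolynomial.coe_aeval_eq_eval]
    exact h1.symm.trans hχ

theorem coe_coordShift_pow (j : Fin d) (k : ℕ) :
    ((coordShift j ^ k : shiftAlgebra d) : TorusSeq d →L[ℂ] TorusSeq d) =
      shiftCLM (k • Pi.single j 1) := by
  induction k with
  | zero => rw [pow_zero, zero_smul, shiftCLM_zero]; rfl
  | succ k ih =>
    rw [pow_succ, add_smul, one_smul, ← shiftCLM_mul, ← ih]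
    rfl

theorem coe_prod_coordShift_pow (α : Fin d →₀ ℕ) :
    ((∏ j, coordShift j ^ α j : shiftAlgebra d) : TorusSeq d →L[ℂ] TorusSeq d) =
      shiftCLM (fun j => (α j : ℤ)) := by
  have h : ∀ s : Finset (Fin d),
      ((∏ j ∈ s, coordShift j ^ α j : shiftAlgebra d) : TorusSeq d →L[ℂ] TorusSeq d) =
        shiftCLM (∑ j ∈ s, α j • Pi.single j 1) := by
    intro s
    induction s using Finset.induction_on with
    | empty => rw [Finset.prod_empty, Finset.sum_empty, shiftCLM_zero]; rfl
    | insert j s hj ih =>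
      rw [Finset.prod_insert hj, Finset.sum_insert hj, ← shiftCLM_mul, ← ih,
        ← coe_coordShift_pow]
      rfl
  rw [h]
  congr 1
  ext i
  simp [Finset.sum_apply, Pi.single_apply]

theorem polyShift_monomial_apply (α : Fin d →₀ ℕ) (c : ℂ) (x : TorusSeq d) :
    (polyShift (MvPolynomial.monomial α c)).1 x = c • shift (fun j => (α j : ℤ)) x := by
  have h : polyShift (MvPolynomial.monomial α c) = c • ∏ j, coordShift j ^ α j := by
    rw [polyShift, MvPolynomial.aeval_monomial, Finsupp.prod_fintype _ _ (by simp),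
      Algebra.smul_def]
  rw [h]
  change c • ((∏ j, coordShift j ^ α j : shiftAlgebra d) : TorusSeq d →L[ℂ] TorusSeq d) x = _
  rw [coe_prod_coordShift_pow, shiftCLM_apply]

theorem polyShift_sum_monomial_apply {ι : Type*} (s : Finset ι) (α : ι → Fin d →₀ ℕ) (c : ι → ℂ)
    (x : TorusSeq d) : (polyShift (∑ i ∈ s, MvPolynomial.monomial (α i) (c i))).1 x =
      ∑ i ∈ s, c i • shift (fun j => (α i j : ℤ)) x := by
  have h : polyShift (∑ i ∈ s, MvPolynomial.monomial (α i) (c i)) =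
      ∑ i ∈ s, polyShift (MvPolynomial.monomial (α i) (c i)) := map_sum _ _ _
  rw [h, ← (shiftAlgebra d).coe_val, map_sum, sum_apply]
  exact Finset.sum_congr rfl fun i _ => polyShift_monomial_apply _ _ _

/-- A polynomial and its reflection define operators with equal norms of values. -/
theorem norm_polyShift_reflectPoly_apply {n : Fin d →₀ ℕ} {p : MvPolynomial (Fin d) ℂ}
    (hdeg : ∀ j, p.degreeOf j ≤ n j) (x : TorusSeq d) :
    ‖(polyShift (reflectPoly n p)).1 x‖ = ‖(polyShift p).1 x‖ := by
  rw [← sq_eq_sq₀ (norm_nonneg _) (norm_nonneg _), ← Complex.ofReal_inj,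
    ← inner_self_eq_ofReal, ← inner_self_eq_ofReal]
  have hp : (polyShift p).1 x =
      ∑ α ∈ p.support, p.coeff α • shift (fun j => (α j : ℤ)) x := by
    conv_lhs => rw [← p.support_sum_monomial_coeff]
    exact polyShift_sum_monomial_apply _ _ _ _
  have hr : (polyShift (reflectPoly n p)).1 x =
      ∑ α ∈ p.support, conj (p.coeff α) • shift (fun j => ((n - α) j : ℤ)) x :=
    polyShift_sum_monomial_apply _ _ _ _
  rw [hp, hr]
  simp only [sum_inner, inner_sum, inner_smul_left, inner_smul_right, Complex.conj_conj, Finset.mul_sum]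
  rw [Finset.sum_comm]
  refine Finset.sum_congr rfl fun α hα => ?_
  refine Finset.sum_congr rfl fun β hβ => ?_
  have h : ∀ γ ∈ p.support, (fun j => ((n - γ) j : ℤ)) = fun j => (n j : ℤ) - γ j := by
    intro γ hγ
    ext j
    have : γ j ≤ n j := (MvPolynomial.monomial_le_degreeOf j hγ).trans (hdeg j)
    rw [Finsupp.tsub_apply, Nat.cast_sub this]
  -- Translating both arguments by `α + β - n` turns the exponents `n - α`, `n - β` into `β`, `α`:
  -- the Fourier form of `|p̃| = |p|` on the torus.
  rw [h α hα, h β hβ,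
    ← LinearIsometry.inner_map_map (shift fun j => (α j : ℤ) + β j - n j) (shift _ x),
    shift_shift, shift_shift]
  have e1 : ((fun j => (α j : ℤ) + β j - n j) + fun j => (n j : ℤ) - α j) =
      fun j => (β j : ℤ) := by ext j; simp
  have e2 : ((fun j => (α j : ℤ) + β j - n j) + fun j => (n j : ℤ) - β j) =
      fun j => (α j : ℤ) := by ext j; simp
  simp only [e1, e2]
  ring

theorem shift_single_mem_nonnegOn (S : Set (Fin d)) (j : Fin d) {x : TorusSeq d}
    (hx : x ∈ coordSubspace (nonnegOn S)) :
    shift (Pi.single j 1) x ∈ coordSubspace (nonnegOn S) := by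
  intro m hm
  refine hx _ fun h => hm fun i hi => (h i hi).trans ?_
  rw [Pi.sub_apply, sub_le_self_iff, Pi.single_apply]
  split_ifs <;> simp

theorem inner_szegoVec_polyShift (z : Polydisk d) (q : MvPolynomial (Fin d) ℂ) {x : TorusSeq d}
    (hx : x ∈ coordSubspace (nonnegOn Set.univ)) :
    inner ℂ (szegoVec z) ((polyShift q).1 x) =
      MvPolynomial.eval z.1 q * inner ℂ (szegoVec z) x := by
  induction q using MvPolynomial.induction_on generalizing x with
  | C a =>
    have : polyShift (MvPolynomial.C a) = a • (1 : shiftAlgebra d) := by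
      rw [polyShift, MvPolynomial.aeval_C, Algebra.algebraMap_eq_smul_one]
    rw [this, MvPolynomial.eval_C, ← inner_smul_right]
    rfl
  | add q r hq hr =>
    have : polyShift (q + r) = polyShift q + polyShift r := map_add _ _ _
    rw [this, map_add, add_mul, ← hq hx, ← hr hx, ← inner_add_right]
    rfl
  | mul_X q j hq =>
    have : polyShift (q * MvPolynomial.X j) = polyShift q * coordShift j := by
      rw [polyShift, map_mul, MvPolynomial.aeval_X]; rfl
    rw [this, map_mul, MvPolynomial.eval_X, mul_assoc, ← inner_szegoVec_shift z j hx,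
      ← hq (shift_single_mem_nonnegOn _ j hx)]
    rfl

/-- Multiplication by the rational inner function `p̃ / p`. -/
theorem exists_inner_multiplier {n : Fin d →₀ ℕ} {p : MvPolynomial (Fin d) ℂ}
    (hdeg : ∀ j, p.degreeOf j ≤ n j)
    (hp : ∀ z : Fin d → ℂ, (∀ j, ‖z j‖ ≤ 1) → MvPolynomial.eval z p ≠ 0) :
    ∃ Φ : TorusSeq d →ₗᵢ[ℂ] TorusSeq d,
      (∀ a x, Φ (shift a x) = shift a (Φ x)) ∧
      (∀ S, ∀ x ∈ coordSubspace (nonnegOn S), Φ x ∈ coordSubspace (nonnegOn S)) ∧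
      ∀ z, ∀ x ∈ coordSubspace (nonnegOn Set.univ),
        MvPolynomial.eval z.1 p * inner ℂ (szegoVec z) (Φ x) =
          MvPolynomial.eval z.1 (reflectPoly n p) * inner ℂ (szegoVec z) x := by
  obtain ⟨u, hu⟩ := isUnit_polyShift hp
  set T : shiftAlgebra d := polyShift (reflectPoly n p) * ↑u⁻¹ with hT
  have hpT : polyShift p * T = polyShift (reflectPoly n p) := by
    rw [hT, ← hu, mul_left_comm, Units.mul_inv, mul_one]
  have hpu : ∀ x, (polyShift p).1 ((↑u⁻¹ : shiftAlgebra d).1 x) = x := fun x => by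
    have h : polyShift p * ↑u⁻¹ = 1 := by rw [← hu, Units.mul_inv]
    exact congrArg (fun R : shiftAlgebra d => R.1 x) h
  refine ⟨⟨T.1.toLinearMap, fun x => ?_⟩, fun a x => ?_, fun S x hx => ?_, fun z x hx => ?_⟩
  · change ‖(polyShift (reflectPoly n p)).1 ((↑u⁻¹ : shiftAlgebra d).1 x)‖ = ‖x‖
    rw [norm_polyShift_reflectPoly_apply hdeg, hpu]
  · exact (congrArg (fun R => R x) (commute_shiftCLM T.2 a)).symm
  · exact apply_mem_of_mem_shiftAlgebra (isClosed_coordSubspace _)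
      (fun j y hy => shift_single_mem_nonnegOn S j hy) T.2 hx
  · have hTx := apply_mem_of_mem_shiftAlgebra (isClosed_coordSubspace _)
      (fun j y hy => shift_single_mem_nonnegOn Set.univ j hy) T.2 hx
    have h := inner_szegoVec_polyShift z (reflectPoly n p) hx
    rw [← hpT] at h
    exact (inner_szegoVec_polyShift z p hTx).symm.trans h

end ShiftAlgebra

/-! ### The model space and its invariant splitting -/

section ModelSpace

open Matrix

variable {d : ℕ}

theorem nonnegOn_mono {S T : Set (Fin d)} (h : S ⊆ T) : nonnegOn T ⊆ nonnegOn S :=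
  fun _ hm j hj => hm j (h hj)

theorem coordSubspace_mono {I J : Set (Fin d → ℤ)} (h : I ⊆ J) :
    coordSubspace I ≤ coordSubspace J :=
  fun _ hx m hm => hx m fun hm' => hm (h hm')

theorem shift_unitVec (a m : Fin d → ℤ) : shift a (unitVec m) = unitVec (m + a) := by
  ext l
  rw [shift_apply, unitVec_apply, unitVec_apply]
  simp only [sub_eq_iff_eq_add]

theorem inner_map_eq_zero_of_unitVec (Φ : TorusSeq d →ₗᵢ[ℂ] TorusSeq d) {I : Set (Fin d → ℤ)}
    {g x : TorusSeq d} (hg : g ∈ coordSubspace I)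
    (h : ∀ m ∈ I, inner ℂ (Φ (unitVec m)) x = 0) : inner ℂ (Φ g) x = 0 := by
  have h1 := lp.hasSum_single (E := fun _ : Fin d → ℤ => ℂ) (p := 2) ENNReal.ofNat_ne_top g
  have h2 := ((innerSL ℂ x).comp Φ.toContinuousLinearMap).hasSum h1
  have h3 : inner ℂ x (Φ g) = 0 := by
    refine h2.unique ?_
    convert hasSum_zero with m
    have h4 : lp.single (E := fun _ : Fin d → ℤ => ℂ) 2 m (g m) = g m • unitVec m := by
      rw [unitVec, ← lp.single_smul, smul_eq_mul, mul_one]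
    by_cases hm : m ∈ I
    · have h5 : inner ℂ x (Φ (unitVec m)) = 0 := inner_eq_zero_symm.1 (h m hm)
      simp [h4, h5]
    · simp [hg m hm]
  exact inner_eq_zero_symm.1 h3

/-- The Hardy space modulo its image under the isometry `Φ`. -/
def modelSpace (Φ : TorusSeq d →ₗᵢ[ℂ] TorusSeq d) : Submodule ℂ (TorusSeq d) :=
  coordSubspace (nonnegOn Set.univ) ⊓
    ((coordSubspace (nonnegOn Set.univ)).map Φ.toLinearMap)ᗮ

/-- The closed span of the compressions to the Hardy space of `Φ g`, where `g` has frequencies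
that are non-negative off `S` and have a negative coordinate in `S`. -/
def complementSpace (Φ : TorusSeq d →ₗᵢ[ℂ] TorusSeq d) (S : Set (Fin d)) :
    Submodule ℂ (TorusSeq d) :=
  ((coordSubspace (nonnegOn Sᶜ \ nonnegOn Set.univ)).map
    ((coordSubspace (nonnegOn S)).starProjection.toLinearMap ∘ₗ
      Φ.toLinearMap)).topologicalClosure

/-- The largest subspace of the model space invariant under the shifts in the directions `S`. -/
def invariantSpace (Φ : TorusSeq d →ₗᵢ[ℂ] TorusSeq d) (S : Set (Fin d)) :
    Submodule ℂ (TorusSeq d) :=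
  modelSpace Φ ⊓ (complementSpace Φ S)ᗮ

variable {Φ : TorusSeq d →ₗᵢ[ℂ] TorusSeq d} {S : Set (Fin d)}

theorem isClosed_modelSpace : IsClosed (modelSpace Φ : Set (TorusSeq d)) :=
  (isClosed_coordSubspace _).inter (Submodule.isClosed_orthogonal _)

instance : CompleteSpace (modelSpace Φ) := isClosed_modelSpace.completeSpace_coe

instance : CompleteSpace (complementSpace Φ S) :=
  (Submodule.isClosed_topologicalClosure _).completeSpace_coe

instance : CompleteSpace (invariantSpace Φ S) :=
  (isClosed_modelSpace.inter (Submodule.isClosed_orthogonal _)).completeSpace_coe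

theorem mem_modelSpace {x : TorusSeq d} : x ∈ modelSpace Φ ↔
    x ∈ coordSubspace (nonnegOn Set.univ) ∧
      ∀ h ∈ coordSubspace (nonnegOn Set.univ), inner ℂ (Φ h) x = 0 := by
  rw [modelSpace, Submodule.mem_inf, Submodule.mem_orthogonal]
  refine and_congr_right fun _ => ⟨fun h y hy => h _ ⟨y, hy, rfl⟩, ?_⟩
  rintro h _ ⟨y, hy, rfl⟩
  exact h y hy

/-- `Φ g` is non-negative off `S` and the projection makes it non-negative on `S`. For `h` in the
Hardy space the projection fixes `Φ h`, so the inner product reduces to `⟪h, g⟫`, which vanishes by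
disjoint supports. -/
theorem complementSpace_le_modelSpace
    (hΦ : ∀ S, ∀ x ∈ coordSubspace (nonnegOn S), Φ x ∈ coordSubspace (nonnegOn S)) :
    complementSpace Φ S ≤ modelSpace Φ := by
  refine Submodule.topologicalClosure_minimal _ ?_ isClosed_modelSpace
  rintro _ ⟨g, hg, rfl⟩
  rw [mem_modelSpace]
  simp only [LinearMap.comp_apply, LinearIsometry.coe_toLinearMap, ContinuousLinearMap.coe_coe]
  constructor
  · intro m hm
    by_cases hmS : m ∈ nonnegOn S
    · rw [starProjection_coordSubspace_apply_mem hmS]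
      refine hΦ Sᶜ g (coordSubspace_mono Set.sdiff_subset hg) m fun hm' => hm fun j _ => ?_
      by_cases hj : j ∈ S
      exacts [hmS j hj, hm' j hj]
    · exact starProjection_coordSubspace_apply_notMem hmS _
  · intro h hh
    have h1 : Φ h ∈ coordSubspace (nonnegOn S) :=
      coordSubspace_mono (nonnegOn_mono (Set.subset_univ S)) (hΦ _ h hh)
    rw [← Submodule.inner_starProjection_left_eq_right,
      Submodule.starProjection_eq_self_iff.2 h1, LinearIsometry.inner_map_map]
    refine inner_eq_zero_of_disjoint fun m => ?_
    by_cases hm : m ∈ nonnegOn Set.univ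
    · exact Or.inr (hg m fun h => h.2 hm)
    · exact Or.inl (hh m hm)

/-- For `j ∉ S` the shift commutes with `Φ` and with the projection, and it preserves the admissible
frequencies of `g`. -/
theorem shift_mem_complementSpace (hcomm : ∀ a x, Φ (shift a x) = shift a (Φ x)) {j : Fin d}
    (hj : j ∉ S) {x : TorusSeq d} (hx : x ∈ complementSpace Φ S) :
    shift (Pi.single j 1) x ∈ complementSpace Φ S := by
  have hle : complementSpace Φ S ≤
      (complementSpace Φ S).comap (shift (Pi.single j 1)).toLinearMap := by
    refine Submodule.topologicalClosure_minimal _ ?_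
      ((Submodule.isClosed_topologicalClosure _).preimage (shift _).continuous)
    rintro _ ⟨g, hg, rfl⟩
    refine Submodule.le_topologicalClosure _ ⟨shift (Pi.single j 1) g, ?_, ?_⟩
    · intro m hm
      refine hg _ fun h => hm ⟨fun i hi => ?_, fun hm' => h.2 fun i _ => ?_⟩
      · refine (h.1 i hi).trans ?_
        rw [Pi.sub_apply, sub_le_self_iff, Pi.single_apply]
        split_ifs <;> simp
      · by_cases hi : i ∈ S
        · have hij : i ≠ j := fun e => hj (e ▸ hi)
          simpa [hij] using hm' i trivial
        · exact h.1 i hi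
    · simp only [LinearMap.comp_apply, LinearIsometry.coe_toLinearMap,
        ContinuousLinearMap.coe_coe, hcomm]
      ext m
      have hiff : m ∈ nonnegOn S ↔ m - Pi.single j 1 ∈ nonnegOn S := by
        refine forall₂_congr fun i hi => ?_
        have hij : i ≠ j := fun e => hj (e ▸ hi)
        simp [hij]
      by_cases hm : m ∈ nonnegOn S
      · rw [starProjection_coordSubspace_apply_mem hm, shift_apply, shift_apply,
          starProjection_coordSubspace_apply_mem (hiff.1 hm)]
      · rw [starProjection_coordSubspace_apply_notMem hm, shift_apply,
          starProjection_coordSubspace_apply_notMem (fun h => hm (hiff.2 h))]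
  exact hle hx

/-- Against `x` in the Hardy space the projection can be dropped. The model space condition then
covers `m` in the orthant, and orthogonality to the complement covers the remaining `m`. -/
theorem mem_invariantSpace {x : TorusSeq d} : x ∈ invariantSpace Φ S ↔
    x ∈ coordSubspace (nonnegOn Set.univ) ∧
      ∀ m ∈ nonnegOn Sᶜ, inner ℂ (Φ (unitVec m)) x = 0 := by
  have hproj : ∀ {x}, x ∈ coordSubspace (nonnegOn Set.univ) → ∀ y,
      inner ℂ ((coordSubspace (nonnegOn S)).starProjection y) x = inner ℂ y x := by
    intro x hx y
    have h1 : x ∈ coordSubspace (nonnegOn S) :=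
      coordSubspace_mono (nonnegOn_mono (Set.subset_univ S)) hx
    rw [Submodule.inner_starProjection_left_eq_right, Submodule.starProjection_eq_self_iff.2 h1]
  rw [invariantSpace, Submodule.mem_inf, complementSpace, Submodule.orthogonal_closure,
    mem_modelSpace, Submodule.mem_orthogonal]
  constructor
  · rintro ⟨⟨hx, hx1⟩, hx2⟩
    refine ⟨hx, fun m hm => ?_⟩
    by_cases hm' : m ∈ nonnegOn Set.univ
    · exact hx1 _ (unitVec_mem hm')
    · rw [← hproj hx]
      exact hx2 _ ⟨unitVec m, unitVec_mem ⟨hm, hm'⟩, rfl⟩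
  · rintro ⟨hx, hx1⟩
    refine ⟨⟨hx, fun h hh => inner_map_eq_zero_of_unitVec Φ hh fun m hm =>
      hx1 m (nonnegOn_mono (Set.subset_univ _) hm)⟩, ?_⟩
    rintro _ ⟨g, hg, rfl⟩
    exact (hproj hx _).trans (inner_map_eq_zero_of_unitVec Φ hg fun m hm => hx1 m hm.1)

/-- The shift moves across the inner product and replaces `m` by `m - e_j`, which stays non-negative
off `S` because `j ∈ S`. -/
theorem shift_mem_invariantSpace (hcomm : ∀ a x, Φ (shift a x) = shift a (Φ x)) {j : Fin d}
    (hj : j ∈ S) {x : TorusSeq d} (hx : x ∈ invariantSpace Φ S) :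
    shift (Pi.single j 1) x ∈ invariantSpace Φ S := by
  rw [mem_invariantSpace] at hx ⊢
  refine ⟨shift_single_mem_nonnegOn _ j hx.1, fun m hm => ?_⟩
  rw [inner_shift_right, ← hcomm, shift_unitVec]
  refine hx.2 _ fun i hi => ?_
  have hij : i ≠ j := fun e => hi (e ▸ hj)
  simpa [hij] using hm i hi

theorem subset_invariantSpace (hcomm : ∀ a x, Φ (shift a x) = shift a (Φ x)) {S : Finset (Fin d)}
    {Y : Set (TorusSeq d)} (hYW : Y ⊆ modelSpace Φ)
    (hY : ∀ j ∈ S, ∀ x ∈ Y, shift (Pi.single j 1) x ∈ Y) : Y ⊆ invariantSpace Φ (S : Set _) := by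
  -- Induction on the total negative part of `m` over `S`: applying the shift to both arguments
  -- trades `m` for `m + e_j` and `x` for its shift, again in `Y`. At zero, `m` lies in the orthant
  -- and the model space condition applies.
  have key : ∀ (N : ℕ) (m : Fin d → ℤ), m ∈ nonnegOn (S : Set (Fin d))ᶜ →
      ∑ j ∈ S, (-m j).toNat = N → ∀ x ∈ Y, inner ℂ (Φ (unitVec m)) x = 0 := by
    intro N
    induction N with
    | zero =>
      intro m hm hN x hx
      refine (mem_modelSpace.1 (hYW hx)).2 _ (unitVec_mem fun j _ => ?_)
      by_cases hj : j ∈ S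
      · have := Finset.sum_eq_zero_iff.1 hN j hj
        lia
      · exact hm j hj
    | succ N ih =>
      intro m hm hN x hx
      obtain ⟨j, hjS, hj⟩ : ∃ j ∈ S, (-m j).toNat ≠ 0 := by
        by_contra! h
        rw [Finset.sum_eq_zero h] at hN
        lia
      rw [← LinearIsometry.inner_map_map (shift (Pi.single j 1)), ← hcomm, shift_unitVec]
      refine ih _ (fun i hi => ?_) ?_ _ (hY j hjS x hx)
      · have hij : i ≠ j := fun e => hi (e ▸ hjS)
        simpa [hij] using hm i hi
      · rw [← Finset.add_sum_erase S _ hjS] at hN ⊢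
        have h1 : ∑ i ∈ S.erase j, (-(m + (Pi.single j 1 : Fin d → ℤ)) i).toNat =
            ∑ i ∈ S.erase j, (-m i).toNat := by
          refine Finset.sum_congr rfl fun i hi => ?_
          simp [Finset.ne_of_mem_erase hi]
        rw [h1]
        simp only [Pi.add_apply, Pi.single_eq_same]
        lia
  exact fun x hx => mem_invariantSpace.2 ⟨(mem_modelSpace.1 (hYW hx)).1, fun m hm =>
    key _ m hm rfl x hx⟩

end ModelSpace

/-! ### Realising `𝒫` as a Gram kernel and assembling the decomposition -/

section Decomposition

open Matrix

variable {d : ℕ}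

/-- The vectors in the model space representing the kernel of a polynomial and its reflection. -/
def modelVec (n : Fin d →₀ ℕ) (p : MvPolynomial (Fin d) ℂ) (Φ : TorusSeq d →ₗᵢ[ℂ] TorusSeq d)
    (z : Polydisk d) : TorusSeq d :=
  conj (MvPolynomial.eval z.1 p) • szegoVec z -
    conj (MvPolynomial.eval z.1 (reflectPoly n p)) • Φ (szegoVec z)

variable {n : Fin d →₀ ℕ} {p : MvPolynomial (Fin d) ℂ} {Φ : TorusSeq d →ₗᵢ[ℂ] TorusSeq d}

/-- The term with `Φ (szegoVec z)` is orthogonal to the model space. The remaining factor `p(z)` is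
non-zero when `p` has no zeros on the polydisk, so separation and multiplication by `z_j` carry over
from the Szegő vectors. -/
theorem inner_modelVec {x : TorusSeq d} (hx : x ∈ modelSpace Φ) (z : Polydisk d) :
    inner ℂ (modelVec n p Φ z) x = MvPolynomial.eval z.1 p * inner ℂ (szegoVec z) x := by
  rw [modelVec, inner_sub_left, inner_smul_left, inner_smul_left,
    (mem_modelSpace.1 hx).2 _ (szegoVec_mem z), Complex.conj_conj, mul_zero, sub_zero]

theorem modelVec_mem
    (hΦ : ∀ S, ∀ x ∈ coordSubspace (nonnegOn S), Φ x ∈ coordSubspace (nonnegOn S))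
    (hmul : ∀ z, ∀ x ∈ coordSubspace (nonnegOn Set.univ),
      MvPolynomial.eval z.1 p * inner ℂ (szegoVec z) (Φ x) =
        MvPolynomial.eval z.1 (reflectPoly n p) * inner ℂ (szegoVec z) x) (z : Polydisk d) :
    modelVec n p Φ z ∈ modelSpace Φ := by
  rw [mem_modelSpace]
  refine ⟨Submodule.sub_mem _ (Submodule.smul_mem _ _ (szegoVec_mem z))
    (Submodule.smul_mem _ _ (hΦ _ _ (szegoVec_mem z))), fun h hh => ?_⟩
  have h1 := congrArg conj (hmul z h hh)
  rw [map_mul, map_mul, inner_conj_symm, inner_conj_symm] at h1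
  rw [modelVec, inner_sub_right, inner_smul_right, inner_smul_right,
    LinearIsometry.inner_map_map, h1, sub_self]

theorem gram_modelVec
    (hΦ : ∀ S, ∀ x ∈ coordSubspace (nonnegOn S), Φ x ∈ coordSubspace (nonnegOn S))
    (hmul : ∀ z, ∀ x ∈ coordSubspace (nonnegOn Set.univ),
      MvPolynomial.eval z.1 p * inner ℂ (szegoVec z) (Φ x) =
        MvPolynomial.eval z.1 (reflectPoly n p) * inner ℂ (szegoVec z) x) :
    gram ℂ (modelVec n p Φ) = reflectKernel n p := by
  ext z ζ
  rw [gram_apply, inner_modelVec (modelVec_mem hΦ hmul ζ), modelVec, inner_sub_right,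
    inner_smul_right, inner_smul_right, mul_sub, mul_left_comm _ _ (inner ℂ _ (Φ _)),
    hmul z _ (szegoVec_mem ζ), inner_szegoVec_szegoVec, reflectKernel, Matrix.of_apply,
    div_eq_mul_inv]
  ring

end Decomposition

end

theorem mainTheorem2 (d : ℕ) (n : Fin d →₀ ℕ) (p : MvPolynomial (Fin d) ℂ)
    (hdeg : ∀ j, p.degreeOf j ≤ n j)
    (hp : ∀ z : Fin d → ℂ, (∀ j, ‖z j‖ ≤ 1) → MvPolynomial.eval z p ≠ 0) :
    ∃ K L : Finset (Fin d) → PolydiskKernel d,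
      (∀ S : Finset (Fin d), S.Nonempty → S ≠ Finset.univ →
        (IsContractiveOn S (K S) ∧ IsPKernel (reflectKernel n p) (K S)) ∧
        (IsContractiveOn S (L S) ∧ IsPKernel (reflectKernel n p) (L S)) ∧
        IsGreatest {K' | IsContractiveOn S K' ∧ K' ≤ reflectKernel n p} (K S)) ∧
      (∀ S T : Finset (Fin d), S.Nonempty → T.Nonempty → Disjoint S T → S ∪ T = Finset.univ →
        reflectKernel n p = K S + L T ∧
        ∀ K' L' : PolydiskKernel d,
          Maximal (fun K'' => IsContractiveOn S K'' ∧ K'' ≤ reflectKernel n p) K' →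
          reflectKernel n p = K' + L' → K' = K S ∧ L' = L T) := by
  obtain ⟨Φ, hcomm, hΦ, hmul⟩ := exists_inner_multiplier hdeg hp
  set v := modelVec n p Φ
  have hP : reflectKernel n p = Matrix.gram ℂ v := (gram_modelVec hΦ hmul).symm
  have hv : ∀ z, v z ∈ modelSpace Φ := modelVec_mem hΦ hmul
  have hpz : ∀ z : Polydisk d, MvPolynomial.eval z.1 p ≠ 0 := fun z => hp _ fun j => (z.2 j).le
  have hsep : ∀ x ∈ modelSpace Φ, ∀ y ∈ modelSpace Φ,
      (∀ z, inner ℂ (v z) x = inner ℂ (v z) y) → x = y := fun x hx y hy h => by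
    refine sub_eq_zero.1 (eq_zero_of_inner_szegoVec_eq_zero
      (Submodule.sub_mem _ (mem_modelSpace.1 hx).1 (mem_modelSpace.1 hy).1) fun z => ?_)
    have h1 := h z
    rw [inner_modelVec hx, inner_modelVec hy] at h1
    rw [inner_sub_right, mul_left_cancel₀ (hpz z) h1, sub_self]
  have hshift : ∀ j, ∀ x ∈ modelSpace Φ, ∀ y ∈ modelSpace Φ,
      (∀ z, inner ℂ (v z) y = z.1 j * inner ℂ (v z) x) → shift (Pi.single j 1) x = y :=
    fun j x hx y hy h => by
      have hx1 := (mem_modelSpace.1 hx).1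
      refine sub_eq_zero.1 (eq_zero_of_inner_szegoVec_eq_zero (Submodule.sub_mem _
        (shift_single_mem_nonnegOn _ j hx1) (mem_modelSpace.1 hy).1) fun z => ?_)
      have h1 := h z
      rw [inner_modelVec hx, inner_modelVec hy, mul_left_comm] at h1
      rw [inner_sub_right, inner_szegoVec_shift z j hx1, mul_left_cancel₀ (hpz z) h1, sub_self]
  have hmulv : ∀ j, ∀ x ∈ modelSpace Φ, shift (Pi.single j 1) x ∈ modelSpace Φ → ∀ z,
      inner ℂ (v z) (shift (Pi.single j 1) x) = z.1 j * inner ℂ (v z) x := fun j x hx hy z => by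
    rw [inner_modelVec hx, inner_modelVec hy, inner_szegoVec_shift z j (mem_modelSpace.1 hx).1,
      mul_left_comm]
  let K : Finset (Fin d) → PolydiskKernel d := fun S =>
    Matrix.gram ℂ fun z => (invariantSpace Φ (S : Set (Fin d))).starProjection (v z)
  -- The complement belongs to `Tᶜ`, so that it is invariant under the shifts in `T` and pairs with
  -- `K Tᶜ`.
  let L : Finset (Fin d) → PolydiskKernel d := fun T =>
    Matrix.gram ℂ fun z => (complementSpace Φ ((Tᶜ : Finset (Fin d)) : Set _)).starProjection (v z)
  have hKL : ∀ S : Finset (Fin d), reflectKernel n p = K S + L Sᶜ := fun S => by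
    rw [hP, gram_eq_add_of_orthogonal v (complementSpace Φ (S : Set (Fin d)))]
    simp only [K, L, compl_compl]
    congr 2
    funext z
    have hN := Submodule.starProjection_apply_mem (complementSpace Φ (S : Set (Fin d))) (v z)
    refine (Submodule.eq_starProjection_of_mem_of_inner_eq_zero
      (K := invariantSpace Φ (S : Set (Fin d)))
      (Submodule.mem_inf.2 ⟨Submodule.sub_mem _ (hv z) (complementSpace_le_modelSpace hΦ hN),
        Submodule.sub_starProjection_mem_orthogonal _⟩) fun w hw => ?_).symm
    rw [sub_sub_cancel]
    exact hw.2 _ hN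
  have hKcontr : ∀ S, IsContractiveOn S (K S) := fun S => ⟨gram_nonneg _, fun j hj =>
    isContractiveAt_gram_starProjection v (shift (Pi.single j 1)) _
      (fun x hx => shift_mem_invariantSpace hcomm hj hx)
      (fun x hx => hmulv j x hx.1 (shift_mem_invariantSpace hcomm hj hx).1)⟩
  have hLcontr : ∀ T, IsContractiveOn T (L T) := fun T => ⟨gram_nonneg _, fun j hj => by
    have hj' : j ∉ ((Tᶜ : Finset (Fin d)) : Set (Fin d)) := by simpa using hj
    exact isContractiveAt_gram_starProjection v (shift (Pi.single j 1)) _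
      (fun x hx => shift_mem_complementSpace hcomm hj' hx)
      (fun x hx => hmulv j x (complementSpace_le_modelSpace hΦ hx)
        (complementSpace_le_modelSpace hΦ (shift_mem_complementSpace hcomm hj' hx)))⟩
  have hgreatest : ∀ S,
      IsGreatest {K' | IsContractiveOn S K' ∧ K' ≤ reflectKernel n p} (K S) := fun S => by
    refine ⟨⟨hKcontr S, hP ▸ gram_starProjection_le v _⟩, fun K' hK' => ?_⟩
    exact le_gram_starProjection_of_isContractiveOn (modelSpace Φ) _ hv S
      (fun j => shift (Pi.single j 1)) hshift (fun Y hYW hY => subset_invariantSpace hcomm hYW hY)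
      hK'.1 (hP ▸ hK'.2)
  refine ⟨K, L, fun S _ _ => ⟨⟨hKcontr S, ?_⟩, ⟨hLcontr S, ?_⟩, hgreatest S⟩,
    fun S T _ _ hST hU => ?_⟩
  · rw [hP]
    exact isPKernel_gram_starProjection (modelSpace Φ) _ hv inf_le_left hsep
  · rw [hP]
    exact isPKernel_gram_starProjection (modelSpace Φ) _ hv (complementSpace_le_modelSpace hΦ) hsep
  · have hT : Sᶜ = T := IsCompl.compl_eq ⟨hST, codisjoint_iff.2 hU⟩
    subst hT
    refine ⟨hKL S, fun K' L' hK' hsum => ?_⟩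
    -- A maximal element must coincide with the greatest one; the other summand is then found by
    -- cancellation.
    have hKS : K' = K S :=
      le_antisymm ((hgreatest S).2 hK'.1) (hK'.2 (hgreatest S).1 ((hgreatest S).2 hK'.1))
    refine ⟨hKS, ?_⟩
    rw [hKL S, hKS] at hsum
    exact (add_left_cancel hsum).symm
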